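/- Let $\mathcal A$ be a unital $C^*$-algebra, let $U$ be a (left) Hilbert $\mathcal A$-module with $\mathcal A$-valued inner product $\langle\cdot,\cdot\rangle$ (linear in the first variable), and assume that $U$ is faithful: if $a\in\mathcal A$ and $au=0$ for all $u\in U$, then $a=0$. Let $(\Omega,\mu)$ be a measure space. All integrals of $\mathcal A$-valued functions are Bochner integrals, measurability of $\mathcal A$-valued functions is Bochner (strong) measurability, and $$L^2(\Omega,\mathcal A)=\Big\{\varphi:\Omega\to\mathcal A\ \text{measurable}:\ \int_\Omega\varphi(\omega)\varphi(\omega)^*\,d\mu(\omega)\ \text{exists in }\mathcal A\Big\}.$$ For $\varphi:\Omega\to\mathcal A$, $F:\Omega\to U$ and measurable $\Omega_1\subseteq\Omega$, the integral $\int_{\Omega_1}\varphi F\,d\mu$ is the (weakly defined) vector $v\in U$ with $\langle v,f\rangle=\int_{\Omega_1}\varphi(\omega)\langle F(\omega),f\rangle\,d\mu(\omega)$ for all $f\in U$. A map $F:\Omega\to U$ is weakly measurable if $\omega\mapsto\langle f,F(\omega)\rangle$ is measurable for every $f\in U$. A weakly measurable $F$ is * a continuous Bessel mapping if there is $B>0$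 such that, for all $f\in U$, $\int_\Omega\langle f,F(\omega)\rangle\langle F(\omega),f\rangle\,d\mu(\omega)$ exists and is $\le B\langle f,f\rangle$; * a continuous frame if there are $A,B>0$ such that, for all $f\in U$, this integral exists and $$A\langle f,f\rangle\le\int_\Omega\langle f,F(\omega)\rangle\langle F(\omega),f\rangle\,d\mu(\omega)\le B\langle f,f\rangle ;$$ * a continuous Riesz basis if (i) $f=0$ is the only $f\in U$ with $\langle f,F(\omega)\rangle=0$ for almost every $\omega$, and (ii) there are $A,B>0$ such that for every $\varphi\in L^2(\Omega,\mathcal A)$ and every measurable $\Omega_1\subseteq\Omega$ with $\mu(\Omega_1)<\infty$ the integral $\int_{\Omega_1}\varphi F\,d\mu$ exists in $U$ and $$A\Big\|\int_{\Omega_1}\varphi\varphi^*\,d\mu\Big\|^{1/2}\le\Big\|\int_{\Omega_1}\varphi F\,d\mu\Big\|\le B\Big\|\int_{\Omega_1}\varphi\varphi^*\,d\mu\Big\|^{1/2}.$$ A dual of a continuous frame $F$ is a continuous Bessel mapping $G:\Omega\to U$ with $\langle f,g\rangle=\int_\Omega\langle f,G(\omega)\rangle\langle F(\omega),g\rangle\,d\mu(\omega)$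 for all $f,g\in U$. A continuous frame $F$ is a Riesz-type frame if it has exactly one dual, where two duals $G,G'$ are identified if for every $f\in U$ one has $\langle f,G(\omega)\rangle=\langle f,G'(\omega)\rangle$ for almost every $\omega$. **Theorem.** Let $F:\Omega\to U$ be a continuous frame with pre-frame operator $T:L^2(\Omega,\mathcal A)\to U$, $T\varphi=\int_\Omega\varphi F\,d\mu$ (weakly defined as above; no boundedness or adjointability of $T$ is assumed). Then $F$ is a continuous Riesz basis for $U$ if and only if $F$ is a Riesz-type frame. -/

import Mathlib

open MeasureTheory

noncomputable section

namespace ContinuousFrame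

/-- The `A`-valued inner product of a (left) Hilbert `A`-module in the convention
"linear in the first variable": `ip A f g = ⟨f, g⟩`, so that `⟨a • f, g⟩ = a * ⟨f, g⟩` and
`⟨f, g⟩⋆ = ⟨g, f⟩`.  Mathlib's `inner` is linear in its second variable, hence the swap. -/
def ip (A : Type*) {U : Type*} [Inner A U] (f g : U) : A := inner A g f

section L2

variable {Ω : Type*} [MeasurableSpace Ω] (A : Type*) [CStarAlgebra A] (μ : Measure Ω)

/-- `L²(Ω, A)`: the (Bochner) measurable `φ : Ω → A` for which the Bochner integral
`∫ |φ(ω)⋆|² dμ(ω)` exists in `A`, where `|φ⋆|² = φ φ⋆`. -/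
def L2 : Set (Ω → A) :=
  {φ | AEStronglyMeasurable φ μ ∧ Integrable (fun ω => φ ω * star (φ ω)) μ}

end L2

section Frames

variable {Ω A U : Type*} [MeasurableSpace Ω] (μ : Measure Ω)
  [CStarAlgebra A] [PartialOrder A] [StarOrderedRing A]
  [NormedAddCommGroup U] [NormedSpace ℂ U] [Module A U] [CStarModule A U]

variable (A) in
/-- `F` is weakly measurable: `ω ↦ ⟨f, F ω⟩` is (Bochner) measurable for every `f`. -/
def WeaklyMeasurable (F : Ω → U) : Prop :=
  ∀ f : U, AEStronglyMeasurable (fun ω => ip A f (F ω)) μ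

variable (A) in
/-- The upper frame inequality
`∫ ⟨f, F ω⟩ ⟨F ω, f⟩ dμ(ω) ≤ B ⟨f, f⟩`, the integral being required to exist. -/
def HasUpperBound (F : Ω → U) (B : ℝ) : Prop :=
  ∀ f : U, Integrable (fun ω => ip A f (F ω) * ip A (F ω) f) μ ∧
    ∫ ω, ip A f (F ω) * ip A (F ω) f ∂μ ≤ B • ip A f f

variable (A) in
/-- Continuous Bessel mappings. -/
def IsBessel (F : Ω → U) : Prop :=
  WeaklyMeasurable A μ F ∧ ∃ B : ℝ, 0 < B ∧ HasUpperBound A μ F B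

variable (A) in
/-- Continuous frames. -/
def IsFrame (F : Ω → U) : Prop :=
  WeaklyMeasurable A μ F ∧ ∃ a B : ℝ, 0 < a ∧ 0 < B ∧ HasUpperBound A μ F B ∧
    ∀ f : U, a • ip A f f ≤ ∫ ω, ip A f (F ω) * ip A (F ω) f ∂μ

/-- `v = ∫ φ(ω) F(ω) dμ(ω)` in the weak sense: `⟨v, f⟩ = ∫ φ(ω) ⟨F ω, f⟩ dμ(ω)` for every
`f : U`, all these integrals being required to exist.  Such a `v` is unique. -/
def IsWeakIntegral (φ : Ω → A) (F : Ω → U) (v : U) : Prop :=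
  ∀ f : U, Integrable (fun ω => φ ω * ip A (F ω) f) μ ∧
    ip A v f = ∫ ω, φ ω * ip A (F ω) f ∂μ

/-- `T : L²(Ω, A) → U` is the pre-frame (synthesis) operator of `F`:
`T φ = ∫ φ(ω) F(ω) dμ(ω)` weakly. -/
def IsPreFrameOperator (F : Ω → U) (T : L2 A μ → U) : Prop :=
  ∀ φ : L2 A μ, IsWeakIntegral μ (φ : Ω → A) F (T φ)

variable (A) in
/-- `G` is a dual of `F`: `G` is a Bessel mapping and `f = ∫ ⟨f, G ω⟩ F ω dμ(ω)` weakly, i.e.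
`⟨f, g⟩ = ∫ ⟨f, G ω⟩ ⟨F ω, g⟩ dμ(ω)` for all `f, g`. -/
def IsDual (F G : Ω → U) : Prop :=
  IsBessel A μ G ∧ ∀ f : U, IsWeakIntegral μ (fun ω => ip A f (G ω)) F f

variable (A) in
/-- Equality of weakly measurable mappings modulo weakly null mappings: for every `f : U`,
`⟨f, G ω⟩ = ⟨f, G' ω⟩` for almost every `ω`. -/
def WeakAEEq (G G' : Ω → U) : Prop :=
  ∀ f : U, ∀ᵐ ω ∂μ, ip A f (G ω) = ip A f (G' ω)

variable (A) in
/-- Riesz-type frames: continuous frames with exactly one dual. -/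
def IsRieszType (F : Ω → U) : Prop :=
  IsFrame A μ F ∧ ∃ G : Ω → U, IsDual A μ F G ∧
    ∀ G' : Ω → U, IsDual A μ F G' → WeakAEEq A μ G G'

variable (A) in
/-- `F` is `μ`-complete: only `f = 0` satisfies `⟨f, F ω⟩ = 0` almost everywhere. -/
def IsMuComplete (F : Ω → U) : Prop :=
  {f : U | ∀ᵐ ω ∂μ, ip A f (F ω) = 0} = {0}

variable (A) in
/-- Continuous Riesz bases.  The vector `v` is the integral `∫_{Ω₁} φ(ω) F(ω) dμ(ω)`. -/
def IsRieszBasis (F : Ω → U) : Prop :=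
  WeaklyMeasurable A μ F ∧ IsMuComplete A μ F ∧
  ∃ a B : ℝ, 0 < a ∧ 0 < B ∧
    ∀ φ ∈ L2 A μ, ∀ Ω₁ : Set Ω, MeasurableSet Ω₁ → μ Ω₁ < ⊤ →
      ∃ v : U, IsWeakIntegral (μ.restrict Ω₁) φ F v ∧
        a * ‖∫ ω in Ω₁, φ ω * star (φ ω) ∂μ‖ ^ (1 / 2 : ℝ) ≤ ‖v‖ ∧
        ‖v‖ ≤ B * ‖∫ ω in Ω₁, φ ω * star (φ ω) ∂μ‖ ^ (1 / 2 : ℝ)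

end Frames

end ContinuousFrame

end

/-! Both properties say that the synthesis operator `T` is injective modulo null functions. If `T φ
= 0` and `G` is a dual, then `G + φ⋆ h` is a dual for every `h : U`, so uniqueness and faithfulness
force `∫ φ φ⋆ = 0`. Conversely, the coefficient functions of two duals differ by an element of the
kernel of `T`. A dual exists because the frame operator `S` is invertible
(`exists_inverse_frameOperator`). If `T` is injective, then `φ` must be the coefficient function of
`S⁻¹ (T φ)`, and the upper frame bound becomes the lower Riesz bound. Conversely, the Riesz lower
bound, given only on sets of finite measure, yields injectivity by exhaustion, the frame's upper
bound controlling the tails. -/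

namespace ContinuousFrame

open Filter Topology

/-! ### Cauchy-Schwarz in a C⋆-algebra -/

section CStar

variable {A : Type*} [CStarAlgebra A] [PartialOrder A] [StarOrderedRing A]

/-- The Cauchy-Schwarz inequality for the Gram data `p = s(x, x)`, `q = s(y, y)`, `r = s(x, y)` of
an `A`-valued semi-inner product `s`. -/
lemma norm_sq_le_of_forall_nonneg {p q r : A} (hp : 0 ≤ p)
    (h : ∀ b : A, 0 ≤ b * p * star b - b * r - star r * star b + q) :
    ‖r‖ ^ 2 ≤ ‖p‖ * ‖q‖ := by
  -- The natural choice `b = ‖p‖⁻¹ r⋆` fails for `p = 0`, so `c > ‖p‖` replaces `‖p‖` and then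
  -- decreases to it.
  have key : ∀ c : ℝ, ‖p‖ < c → ‖r‖ ^ 2 ≤ c * ‖q‖ := by
    intro c hc
    have hc0 : 0 < c := (norm_nonneg p).trans_lt hc
    have h1 := h (c⁻¹ • star r)
    have h2 : star r * p * r ≤ ‖p‖ • (star r * r) :=
      CStarAlgebra.star_left_conjugate_le_norm_smul (.of_nonneg hp)
    have h3 : ‖p‖ • (star r * r) ≤ c • (star r * r) :=
      smul_le_smul_of_nonneg_right hc.le (star_mul_self_nonneg r)
    have h4 : (c⁻¹ * c⁻¹) • (star r * p * r) ≤ (c⁻¹ * c⁻¹) • c • (star r * r) :=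
      smul_le_smul_of_nonneg_left (h2.trans h3) (by positivity)
    have h5 : c⁻¹ • (star r * r) ≤ q := by
      rw [← sub_nonneg]
      refine h1.trans ?_
      rw [← sub_nonneg] at h4 ⊢
      refine h4.trans_eq ?_
      have e : (c⁻¹ * c⁻¹) • c • (star r * r) = c⁻¹ • (star r * r) := by
        rw [smul_smul]; congr 1; field_simp
      rw [e]
      simp only [star_smul, star_star, star_trivial, smul_mul_assoc, mul_smul_comm, smul_smul]
      abel
    have h6 : ‖c⁻¹ • (star r * r)‖ ≤ ‖q‖ :=
      CStarAlgebra.norm_le_norm_of_nonneg_of_le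
        (smul_nonneg (by positivity) (star_mul_self_nonneg r)) h5
    rw [norm_smul, CStarRing.norm_star_mul_self, Real.norm_of_nonneg (by positivity),
      inv_mul_le_iff₀ hc0] at h6
    nlinarith
  refine ge_of_tendsto (f := fun c : ℝ => c * ‖q‖) (x := 𝓝[>] ‖p‖) ?_
    (eventually_nhdsWithin_of_forall fun c hc => key c hc)
  exact ((continuous_id.mul continuous_const).tendsto _).mono_left nhdsWithin_le_nhds

end CStar

/-! ### Square-integrable `A`-valued functions -/

section Integrals

variable {Ω A : Type*} [MeasurableSpace Ω] {μ : Measure Ω} [CStarAlgebra A]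

/-- By the C⋆-identity `‖φ φ⋆‖ = ‖φ‖²`. -/
lemma mem_L2_iff {φ : Ω → A} : φ ∈ L2 A μ ↔ MemLp φ 2 μ := by
  constructor
  · rintro ⟨h1, h2⟩
    rw [memLp_two_iff_integrable_sq_norm h1]
    simpa only [CStarRing.norm_self_mul_star, pow_two] using h2.norm
  · intro h
    refine ⟨h.1, ?_⟩
    exact memLp_one_iff_integrable.1 (h.star.mul' h)

lemma integrable_mul_star {φ ψ : Ω → A} (hφ : MemLp φ 2 μ) (hψ : MemLp ψ 2 μ) :
    Integrable (fun ω => φ ω * star (ψ ω)) μ :=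
  memLp_one_iff_integrable.1 (hψ.star.mul' hφ)

lemma star_integral (φ : Ω → A) : star (∫ ω, φ ω ∂μ) = ∫ ω, star (φ ω) ∂μ :=
  ((starL' ℝ (A := A)).integral_comp_comm φ).symm

lemma setIntegral_mul_star {φ : Ω → A} {s : Set Ω} (hs : MeasurableSet s) :
    ∫ ω in s, φ ω * star (φ ω) ∂μ = ∫ ω, s.indicator φ ω * star (s.indicator φ ω) ∂μ := by
  rw [← integral_indicator hs]
  congr 1
  ext ω
  by_cases h : ω ∈ s <;> simp [h]

variable [PartialOrder A] [StarOrderedRing A]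

lemma integral_mul_star_nonneg (φ : Ω → A) : 0 ≤ ∫ ω, φ ω * star (φ ω) ∂μ :=
  integral_nonneg fun _ => mul_star_self_nonneg _

/-- The Cauchy-Schwarz inequality in `L²(Ω, A)`. -/
lemma norm_integral_mul_star_sq_le {φ ψ : Ω → A} (hφ : MemLp φ 2 μ) (hψ : MemLp ψ 2 μ) :
    ‖∫ ω, φ ω * star (ψ ω) ∂μ‖ ^ 2 ≤
      ‖∫ ω, φ ω * star (φ ω) ∂μ‖ * ‖∫ ω, ψ ω * star (ψ ω) ∂μ‖ := by
  refine norm_sq_le_of_forall_nonneg (integral_mul_star_nonneg φ) fun b => ?_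
  have hpp := integrable_mul_star hφ hφ
  have hpq := integrable_mul_star hφ hψ
  have hqp := integrable_mul_star hψ hφ
  have hqq := integrable_mul_star hψ hψ
  have i1 : Integrable (fun ω => b * (φ ω * star (φ ω)) * star b) μ :=
    (hpp.const_mul b).mul_const _
  have i2 : Integrable (fun ω => b * (φ ω * star (ψ ω))) μ := hpq.const_mul b
  have i3 : Integrable (fun ω => ψ ω * star (φ ω) * star b) μ := hqp.mul_const _
  have i4 : Integrable (fun ω => b * (φ ω * star (φ ω)) * star b - b * (φ ω * star (ψ ω))) μ :=
    i1.sub i2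
  have i5 : Integrable (fun ω => b * (φ ω * star (φ ω)) * star b - b * (φ ω * star (ψ ω))
      - ψ ω * star (φ ω) * star b) μ := i4.sub i3
  have e : star (∫ ω, φ ω * star (ψ ω) ∂μ) = ∫ ω, ψ ω * star (φ ω) ∂μ := by
    simp [star_integral]
  rw [e, ← integral_const_mul_of_integrable hpp, ← integral_mul_const_of_integrable (hpp.const_mul b),
    ← integral_const_mul_of_integrable hpq, ← integral_mul_const_of_integrable hqp,
    ← integral_sub i1 i2, ← integral_sub i4 i3, ← integral_add i5 hqq]
  refine (integral_mul_star_nonneg fun ω => b * φ ω - ψ ω).trans_eq (integral_congr_ae ?_)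
  refine .of_forall fun ω => ?_
  simp only [star_sub, star_mul]
  noncomm_ring

/-- A nonnegative integrable function with vanishing integral vanishes almost everywhere. -/
lemma ae_eq_zero_of_integral_eq_zero {f : Ω → A} (hf : Integrable f μ) (h0 : ∀ ω, 0 ≤ f ω)
    (h : ∫ ω, f ω ∂μ = 0) : f =ᵐ[μ] 0 := by
  refine hf.ae_eq_zero_of_forall_setIntegral_eq_zero fun s hs _ => le_antisymm ?_ ?_
  · have h1 := integral_add_compl hs hf
    rw [← h, ← h1]
    exact le_add_of_nonneg_right (integral_nonneg fun ω => h0 ω)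
  · exact integral_nonneg fun ω => h0 ω

lemma ae_eq_zero_of_integral_mul_star_eq_zero {φ : Ω → A} (hφ : MemLp φ 2 μ)
    (h : ∫ ω, φ ω * star (φ ω) ∂μ = 0) : φ =ᵐ[μ] 0 := by
  filter_upwards [ae_eq_zero_of_integral_eq_zero (integrable_mul_star hφ hφ)
    (fun ω => mul_star_self_nonneg _) h] with ω hω
  exact CStarRing.mul_star_self_eq_zero_iff _ |>.1 hω

end Integrals

/-! ### Inner product rules, linear in the first variable -/

section InnerProduct

variable {A U : Type*} [CStarAlgebra A] [PartialOrder A]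
  [NormedAddCommGroup U] [NormedSpace ℂ U] [Module A U] [CStarModule A U]

@[simp] lemma star_ip (f g : U) : star (ip A f g) = ip A g f := CStarModule.star_inner _ _

lemma ip_add_left (f g h : U) : ip A (f + g) h = ip A f h + ip A g h :=
  CStarModule.inner_add_right

lemma ip_add_right (f g h : U) : ip A f (g + h) = ip A f g + ip A f h :=
  CStarModule.inner_add_left

lemma ip_sub_left (f g h : U) : ip A (f - g) h = ip A f h - ip A g h :=
  CStarModule.inner_sub_right

lemma ip_sub_right (f g h : U) : ip A f (g - h) = ip A f g - ip A f h :=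
  CStarModule.inner_sub_left

lemma ip_smul_left (a : A) (f g : U) : ip A (a • f) g = a * ip A f g :=
  CStarModule.inner_op_smul_right

lemma ip_smul_right (a : A) (f g : U) : ip A f (a • g) = ip A f g * star a :=
  CStarModule.inner_op_smul_left

lemma ip_complex_smul_left (c : ℂ) (f g : U) : ip A (c • f) g = c • ip A f g :=
  CStarModule.inner_smul_right_complex

lemma ip_real_smul_left (c : ℝ) (f g : U) : ip A (c • f) g = c • ip A f g :=
  CStarModule.inner_smul_right_real

lemma ip_real_smul_right (c : ℝ) (f g : U) : ip A f (c • g) = c • ip A f g :=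
  CStarModule.inner_smul_left_real

lemma ip_self_nonneg (f : U) : 0 ≤ ip A f f := CStarModule.inner_self_nonneg

lemma ip_self_eq_zero {f : U} : ip A f f = 0 ↔ f = 0 := CStarModule.inner_self

variable (A) in
lemma norm_sq_eq_norm_ip (f : U) : ‖f‖ ^ 2 = ‖ip A f f‖ := CStarModule.norm_sq_eq A

variable (A) in
lemma eq_of_forall_ip_eq {f g : U} (h : ∀ x, ip A f x = ip A g x) : f = g := by
  rw [← sub_eq_zero, ← ip_self_eq_zero (A := A), ip_sub_left, h, sub_self]

variable [StarOrderedRing A]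

lemma ip_mul_ip_le (f g : U) : ip A f g * ip A g f ≤ ‖g‖ ^ 2 • ip A f f :=
  CStarModule.inner_mul_inner_swap_le

end InnerProduct

/-! ### Synthesis operator, frame operator, canonical dual -/

section Operators

variable {Ω A U : Type*} [MeasurableSpace Ω] {μ : Measure Ω}
  [CStarAlgebra A] [PartialOrder A]
  [NormedAddCommGroup U] [NormedSpace ℂ U] [Module A U] [CStarModule A U]
  {F : Ω → U} {φ ψ : Ω → A} {a B : ℝ}

lemma HasUpperBound.memLp_ip (hB : HasUpperBound A μ F B) (hw : WeaklyMeasurable A μ F) (f : U) :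
    MemLp (fun ω => ip A f (F ω)) 2 μ :=
  mem_L2_iff.1 ⟨hw f, by simpa using (hB f).1⟩

lemma IsWeakIntegral.unique {v w : U} (hv : IsWeakIntegral μ φ F v)
    (hw : IsWeakIntegral μ φ F w) : v = w :=
  eq_of_forall_ip_eq A fun x => by rw [(hv x).2, (hw x).2]

lemma IsWeakIntegral.add {v w : U} (hv : IsWeakIntegral μ φ F v)
    (hw : IsWeakIntegral μ ψ F w) : IsWeakIntegral μ (fun ω => φ ω + ψ ω) F (v + w) := by
  intro f
  simp only [add_mul]
  exact ⟨(hv f).1.add (hw f).1, by rw [integral_add (hv f).1 (hw f).1, ip_add_left, (hv f).2,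
    (hw f).2]⟩

lemma IsWeakIntegral.sub {v w : U} (hv : IsWeakIntegral μ φ F v)
    (hw : IsWeakIntegral μ ψ F w) : IsWeakIntegral μ (fun ω => φ ω - ψ ω) F (v - w) := by
  intro f
  simp only [sub_mul]
  exact ⟨(hv f).1.sub (hw f).1, by rw [integral_sub (hv f).1 (hw f).1, ip_sub_left, (hv f).2,
    (hw f).2]⟩

lemma IsWeakIntegral.smul {v : U} (hv : IsWeakIntegral μ φ F v) (b : A) :
    IsWeakIntegral μ (fun ω => b * φ ω) F (b • v) := by
  intro f
  simp only [mul_assoc]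
  exact ⟨(hv f).1.const_mul b, by
    rw [integral_const_mul_of_integrable (hv f).1, ip_smul_left, (hv f).2]⟩

lemma IsWeakIntegral.complex_smul {v : U} (hv : IsWeakIntegral μ φ F v) (c : ℂ) :
    IsWeakIntegral μ (fun ω => c • φ ω) F (c • v) := by
  intro f
  simp only [smul_mul_assoc]
  exact ⟨(hv f).1.smul c, by rw [integral_smul, ip_complex_smul_left, (hv f).2]⟩

lemma isWeakIntegral_indicator_iff {s : Set Ω} (hs : MeasurableSet s) {v : U} :
    IsWeakIntegral μ (s.indicator φ) F v ↔ IsWeakIntegral (μ.restrict s) φ F v := by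
  have h (f : U) : (fun ω => s.indicator φ ω * ip A (F ω) f) =
      s.indicator fun ω => φ ω * ip A (F ω) f := by
    ext ω
    by_cases hω : ω ∈ s <;> simp [hω]
  unfold IsWeakIntegral
  simp only [h, integral_indicator hs, integrable_indicator_iff hs, IntegrableOn]

variable [StarOrderedRing A]

lemma integral_ip_mul_ip_nonneg (F : Ω → U) (f : U) :
    0 ≤ ∫ ω, ip A f (F ω) * ip A (F ω) f ∂μ := by
  simpa using integral_mul_star_nonneg (μ := μ) fun ω => ip A f (F ω)

lemma HasUpperBound.norm_integral_le (hB : HasUpperBound A μ F B) (hB0 : 0 < B) (f : U) :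
    ‖∫ ω, ip A f (F ω) * ip A (F ω) f ∂μ‖ ≤ B * ‖f‖ ^ 2 := by
  refine (CStarAlgebra.norm_le_norm_of_nonneg_of_le
    (integral_ip_mul_ip_nonneg F f) (hB f).2).trans_eq ?_
  rw [norm_smul, Real.norm_of_nonneg hB0.le, norm_sq_eq_norm_ip A]

/-- The synthesis operator of a Bessel mapping is bounded for the norm `‖∫ φ φ⋆‖^(1/2)`. -/
lemma IsWeakIntegral.norm_sq_le {v : U} (hv : IsWeakIntegral μ φ F v) (hφ : MemLp φ 2 μ)
    (hw : WeaklyMeasurable A μ F) (hB : HasUpperBound A μ F B) (hB0 : 0 < B) :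
    ‖v‖ ^ 2 ≤ B * ‖∫ ω, φ ω * star (φ ω) ∂μ‖ := by
  -- Testing against `v` itself turns Cauchy-Schwarz into a bound on `‖v‖⁴`; a factor `‖v‖²` then
  -- cancels.
  have h := norm_integral_mul_star_sq_le hφ (hB.memLp_ip hw v)
  simp only [star_ip] at h
  rw [← (hv v).2, ← norm_sq_eq_norm_ip] at h
  have h2 := hB.norm_integral_le hB0 v
  rcases (norm_nonneg v).eq_or_lt with h0 | h0
  · rw [← h0, zero_pow two_ne_zero]
    positivity
  · have h3 := mul_le_mul_of_nonneg_left h2 (norm_nonneg (∫ ω, φ ω * star (φ ω) ∂μ))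
    have h4 : 0 < ‖v‖ ^ 2 := by positivity
    refine le_of_mul_le_mul_right (?_ : _ * ‖v‖ ^ 2 ≤ _ * ‖v‖ ^ 2) h4
    nlinarith

/-- A positive contraction-type estimate: a symmetric `A`-linear operator `P` with
`0 ≤ ⟨P f, f⟩ ≤ c ⟨f, f⟩` has norm at most `c`. -/
lemma norm_le_of_ip_le {P : U → U} (hsub : ∀ f g, P (f - g) = P f - P g)
    (hsmul : ∀ (b : A) f, P (b • f) = b • P f) (hsymm : ∀ f g, ip A (P f) g = ip A f (P g))
    (h0 : ∀ f, 0 ≤ ip A (P f) f) {c : ℝ} (hc : 0 ≤ c) (hP : ∀ f, ip A (P f) f ≤ c • ip A f f)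
    (f : U) : ‖P f‖ ≤ c * ‖f‖ := by
  have hn (g : U) : ‖ip A (P g) g‖ ≤ c * ‖g‖ ^ 2 := by
    refine (CStarAlgebra.norm_le_norm_of_nonneg_of_le (h0 g) (hP g)).trans_eq ?_
    rw [norm_smul, Real.norm_of_nonneg hc, norm_sq_eq_norm_ip A]
  -- Cauchy-Schwarz for the form `⟨P ·, ·⟩` at the pair `f`, `P f`.
  have h := norm_sq_le_of_forall_nonneg (p := ip A (P f) f) (q := ip A (P (P f)) (P f))
    (r := ip A (P f) (P f)) (h0 f) fun b => by
      refine (h0 (b • f - P f)).trans_eq ?_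
      rw [hsub, hsmul, ip_sub_left, ip_sub_right, ip_sub_right, ip_smul_left, ip_smul_left,
        ip_smul_right, ip_smul_right, hsymm (P f) f, star_ip, mul_assoc]
      abel
  rw [← norm_sq_eq_norm_ip] at h
  have h1 := mul_le_mul (hn f) (hn (P f)) (norm_nonneg _) (by positivity)
  rcases (norm_nonneg (P f)).eq_or_lt with h2 | h2
  · rw [← h2]
    positivity
  · refine le_of_sq_le_sq ?_ (by positivity)
    have h4 : 0 < ‖P f‖ ^ 2 := by positivity
    refine le_of_mul_le_mul_right (?_ : _ * ‖P f‖ ^ 2 ≤ _ * ‖P f‖ ^ 2) h4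
    nlinarith

/-- The frame operator of a continuous frame is invertible; `R` is its (self-adjoint) inverse. -/
lemma exists_inverse_frameOperator [CompleteSpace U] (hw : WeaklyMeasurable A μ F) (ha : 0 < a)
    (hB0 : 0 < B) (hB : HasUpperBound A μ F B)
    (hlow : ∀ f : U, a • ip A f f ≤ ∫ ω, ip A f (F ω) * ip A (F ω) f ∂μ)
    (hT : ∀ φ : Ω → A, MemLp φ 2 μ → ∃ v, IsWeakIntegral μ φ F v) :
    ∃ R : U →L[ℂ] U, (∀ f, IsWeakIntegral μ (fun ω => ip A (R f) (F ω)) F f) ∧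
      ∀ f g, ip A (R f) g = ip A f (R g) := by
  choose S hS using fun f => hT _ (hB.memLp_ip hw f)
  have Sadd (f g : U) : S (f + g) = S f + S g :=
    (hS (f + g)).unique (by simpa only [ip_add_left] using (hS f).add (hS g))
  have Ssub (f g : U) : S (f - g) = S f - S g :=
    (hS (f - g)).unique (by simpa only [ip_sub_left] using (hS f).sub (hS g))
  have Ssmul (b : A) (f : U) : S (b • f) = b • S f :=
    (hS (b • f)).unique (by simpa only [ip_smul_left] using (hS f).smul b)
  have Scsmul (c : ℂ) (f : U) : S (c • f) = c • S f :=
    (hS (c • f)).unique (by simpa only [ip_complex_smul_left] using (hS f).complex_smul c)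
  have Ssymm (f g : U) : ip A (S f) g = ip A f (S g) := by
    rw [← star_ip (S g) f, (hS f g).2, (hS g f).2, star_integral]
    simp
  -- With this `t`, the bounds `a ≤ S ≤ B` give `0 ≤ 1 - t S ≤ c < 1`, so a Neumann series inverts
  -- `t S`.
  set t : ℝ := (a + B)⁻¹ with ht
  have ht0 : 0 < t := by positivity
  set c : ℝ := 1 - t * a with hc
  have htB : t * B = c := by rw [hc, ht]; field_simp; ring
  have hc0 : 0 ≤ c := by rw [← htB]; positivity
  have hc1 : c < 1 := by rw [hc]; linarith [mul_pos ht0 ha]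
  let P : U →ₗ[ℂ] U :=
    { toFun := fun f => f - t • S f
      map_add' := fun f g => by rw [Sadd, smul_add]; abel
      map_smul' := fun z f => by
        rw [Scsmul, smul_sub, smul_comm t z, RingHom.id_apply] }
  have hP (f : U) : P f = f - t • S f := rfl
  have hPip (f g : U) : ip A (P f) g = ip A f g - t • ip A (S f) g := by
    rw [hP, ip_sub_left, ip_real_smul_left]
  have hPb (f : U) : ‖P f‖ ≤ c * ‖f‖ := by
    refine norm_le_of_ip_le (A := A) (P := P) (map_sub P) (fun b f => ?_) (fun f g => ?_)
      (fun f => ?_) hc0 (fun f => ?_) f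
    · refine eq_of_forall_ip_eq A fun x => ?_
      rw [hPip, ip_smul_left, ip_smul_left, hPip, Ssmul, ip_smul_left, mul_sub, mul_smul_comm]
    · rw [hPip, ← star_ip (P g) f, hPip, star_sub, star_smul, star_trivial t, star_ip,
        star_ip, Ssymm]
    · rw [hPip, sub_nonneg, (hS f f).2]
      refine (smul_le_smul_of_nonneg_left (hB f).2 ht0.le).trans ?_
      rw [smul_smul, htB]
      exact (smul_le_smul_of_nonneg_right hc1.le (ip_self_nonneg f)).trans_eq (one_smul _ _)
    · rw [hPip, hc, sub_smul, one_smul, mul_smul, (hS f f).2]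
      exact sub_le_sub_left (smul_le_smul_of_nonneg_left (hlow f) ht0.le) _
  have hPn : ‖P.mkContinuous c hPb‖ < 1 := (P.mkContinuous_norm_le hc0 hPb).trans_lt hc1
  obtain ⟨V, hV⟩ := (isUnit_one_sub_of_norm_lt_one hPn).exists_right_inv
  have hV' (f : U) : t • S (V f) = f := by
    have := congrArg (fun W : U →L[ℂ] U => W f) hV
    simpa [hP] using this
  have hR (f : U) : S (((t : ℂ) • V) f) = f := by
    rw [smul_apply, Scsmul, Complex.coe_smul, hV']
  refine ⟨(t : ℂ) • V, fun f => ?_, fun f g => ?_⟩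
  · have := hS (((t : ℂ) • V) f)
    rwa [hR] at this
  · conv_lhs => rw [← hR g, ← Ssymm, hR]

/-- The canonical dual of a continuous frame. -/
lemma isDual_inverse_frameOperator (hw : WeaklyMeasurable A μ F) (ha : 0 < a)
    (hB : HasUpperBound A μ F B)
    (hlow : ∀ f : U, a • ip A f f ≤ ∫ ω, ip A f (F ω) * ip A (F ω) f ∂μ)
    {R : U →L[ℂ] U} (hR : ∀ f, IsWeakIntegral μ (fun ω => ip A (R f) (F ω)) F f)
    (hRs : ∀ f g, ip A (R f) g = ip A f (R g)) : IsDual A μ F fun ω => R (F ω) := by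
  refine ⟨⟨fun f => ?_, a⁻¹, by positivity, fun f => ?_⟩, fun f => ?_⟩
  · simpa only [hRs] using hw (R f)
  · simp only [hRs (F _), ← hRs f]
    refine ⟨(hB (R f)).1, ?_⟩
    rw [← (hR f (R f)).2]
    have h1 : a • ip A (R f) (R f) ≤ ip A f (R f) := by
      rw [(hR f (R f)).2]
      exact hlow (R f)
    -- The integral equals `⟨f, R f⟩`; this square together with `h1` bounds it by `a⁻¹ ⟨f, f⟩`.
    have h2 : 0 ≤ a⁻¹ • ip A (a • R f - f) (a • R f - f) :=
      smul_nonneg (by positivity) (ip_self_nonneg _)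
    have h3 : a⁻¹ • ip A (a • R f - f) (a • R f - f) =
        a • ip A (R f) (R f) - ip A f (R f) - ip A f (R f) + a⁻¹ • ip A f f := by
      simp only [ip_sub_left, ip_sub_right, ip_real_smul_left, ip_real_smul_right, hRs f f,
        smul_sub, inv_smul_smul₀ ha.ne']
      abel
    rw [h3] at h2
    have h4 : 0 ≤ (ip A f (R f) - a • ip A (R f) (R f)) + (a • ip A (R f) (R f) - ip A f (R f)
        - ip A f (R f) + a⁻¹ • ip A f f) := add_nonneg (sub_nonneg.2 h1) h2
    rw [← sub_nonneg]
    exact h4.trans_eq (by abel)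
  · simpa only [← hRs] using hR f

end Operators

/-! ### Injectivity of synthesis and the two implications -/

section Riesz

variable {Ω A U : Type*} [MeasurableSpace Ω] {μ : Measure Ω}
  [CStarAlgebra A] [PartialOrder A]
  [NormedAddCommGroup U] [NormedSpace ℂ U] [Module A U] [CStarModule A U]
  {F : Ω → U} {φ : Ω → A}

lemma IsBessel.memLp_ip {G : Ω → U} (hG : IsBessel A μ G) (f : U) :
    MemLp (fun ω => ip A f (G ω)) 2 μ :=
  let ⟨_, _, hB⟩ := hG.2
  hB.memLp_ip hG.1 f

lemma IsFrame.isBessel (hF : IsFrame A μ F) : IsBessel A μ F :=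
  let ⟨hw, _, B, _, hB0, hB, _⟩ := hF
  ⟨hw, B, hB0, hB⟩

/-- Elements of `A` annihilated by all inner products of a faithful module vanish. -/
lemma eq_zero_of_forall_mul_ip_eq_zero (hU : ∀ a : A, (∀ u : U, a • u = 0) → a = 0) {a : A}
    (h : ∀ f g : U, a * ip A f g = 0) : a = 0 :=
  hU a fun u => ip_self_eq_zero (A := A).1 <| by rw [ip_smul_left, h]

variable [StarOrderedRing A]

/-- The perturbation used on duals: its coefficients `⟨f, h⟩ φ` are synthesized to `⟨f, h⟩ • T φ`.
-/
lemma isBessel_star_smul (hφ : MemLp φ 2 μ) (h : U) :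
    IsBessel A μ fun ω => star (φ ω) • h := by
  have e (f : U) (ω : Ω) : ip A f (star (φ ω) • h) = ip A f h * φ ω := by
    rw [ip_smul_right, star_star]
  have e' (f : U) (ω : Ω) : ip A (star (φ ω) • h) f = star (φ ω) * ip A h f := by
    rw [ip_smul_left]
  have hi := integrable_mul_star hφ hφ
  set b := ∫ ω, φ ω * star (φ ω) ∂μ with hb
  refine ⟨fun f => ?_, (‖b‖ + 1) * (‖h‖ ^ 2 + 1), by positivity, fun f => ?_⟩
  · simpa only [e] using hφ.1.const_mul (ip A f h)
  · have e2 : (fun ω => ip A f (star (φ ω) • h) * ip A (star (φ ω) • h) f) =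
        fun ω => ip A f h * (φ ω * star (φ ω)) * ip A h f := by
      ext ω
      rw [e, e']
      noncomm_ring
    rw [e2]
    refine ⟨(hi.const_mul _).mul_const _, ?_⟩
    rw [integral_mul_const_of_integrable (hi.const_mul _), integral_const_mul_of_integrable hi,
      ← hb]
    have h1 : ip A f h * b * ip A h f ≤ ‖b‖ • (ip A f h * ip A h f) := by
      have := CStarAlgebra.star_right_conjugate_le_norm_smul (a := ip A f h)
        (.of_nonneg (integral_mul_star_nonneg φ : 0 ≤ b))
      rwa [star_ip] at this
    have h2 : ‖b‖ • (ip A f h * ip A h f) ≤ ‖b‖ • ‖h‖ ^ 2 • ip A f f :=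
      smul_le_smul_of_nonneg_left (ip_mul_ip_le f h) (norm_nonneg _)
    refine (h1.trans h2).trans ?_
    rw [smul_smul]
    refine smul_le_smul_of_nonneg_right ?_ (ip_self_nonneg f)
    gcongr <;> linarith

lemma IsBessel.add {G H : Ω → U} (hG : IsBessel A μ G) (hH : IsBessel A μ H) :
    IsBessel A μ fun ω => G ω + H ω := by
  have hm (f : U) := (hG.memLp_ip (A := A) f).add (hH.memLp_ip f)
  obtain ⟨hGw, B, hB0, hB⟩ := hG
  obtain ⟨hHw, C, hC0, hC⟩ := hH
  refine ⟨fun f => ?_, 2 * B + 2 * C, by positivity, fun f => ?_⟩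
  · simp only [ip_add_right]
    exact (hGw f).add (hHw f)
  · have hi := integrable_mul_star (hm f) (hm f)
    simp only [Pi.add_apply, ← ip_add_right, star_ip] at hi
    refine ⟨hi, ?_⟩
    have iG : Integrable (fun ω => (2 : ℝ) • (ip A f (G ω) * ip A (G ω) f)) μ := (hB f).1.smul 2
    have iH : Integrable (fun ω => (2 : ℝ) • (ip A f (H ω) * ip A (H ω) f)) μ := (hC f).1.smul 2
    have hi2 : Integrable (fun ω => (2 : ℝ) • (ip A f (G ω) * ip A (G ω) f) +
        (2 : ℝ) • (ip A f (H ω) * ip A (H ω) f)) μ := iG.add iH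
    refine (integral_mono hi hi2 fun ω => ?_).trans ?_
    -- Parallelogram law: `|x + y|² ≤ 2|x|² + 2|y|²` since `|x - y|² ≥ 0`.
    · have := mul_star_self_nonneg (ip A f (G ω) - ip A f (H ω))
      rw [← sub_nonneg]
      refine this.trans_eq ?_
      simp only [star_sub, star_ip, ip_add_left, ip_add_right, two_smul]
      noncomm_ring
    · rw [integral_add iG iH, integral_smul, integral_smul, add_smul, mul_smul,
        mul_smul]
      exact add_le_add (smul_le_smul_of_nonneg_left (hB f).2 zero_le_two)
        (smul_le_smul_of_nonneg_left (hC f).2 zero_le_two)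

/-- The synthesis operator of a Riesz-type frame of a faithful module is injective. -/
lemma IsRieszType.integral_mul_star_eq_zero (hU : ∀ a : A, (∀ u : U, a • u = 0) → a = 0)
    (hF : IsRieszType A μ F) (hφ : MemLp φ 2 μ) (h0 : IsWeakIntegral μ φ F 0) :
    ∫ ω, φ ω * star (φ ω) ∂μ = 0 := by
  obtain ⟨-, G, hG, huniq⟩ := hF
  -- The exceptional null sets depend on `f` and `h`, so faithfulness is applied to the integral
  -- rather than pointwise.
  refine eq_zero_of_forall_mul_ip_eq_zero hU fun h f => ?_
  have hd : IsDual A μ F fun ω => G ω + star (φ ω) • h := by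
    refine ⟨hG.1.add (isBessel_star_smul hφ h), fun g => ?_⟩
    have := (hG.2 g).add (h0.smul (ip A g h))
    simpa only [smul_zero, add_zero, ip_add_right, ip_smul_right, star_star] using this
  have hae : ∀ᵐ ω ∂μ, ip A f h * φ ω = 0 := by
    filter_upwards [huniq _ hd f] with ω hω
    simpa [ip_add_right, ip_smul_right] using hω
  have hi := integrable_mul_star hφ hφ
  rw [← integral_mul_const_of_integrable hi]
  refine integral_eq_zero_of_ae ?_
  filter_upwards [hae] with ω hω
  have : star (ip A f h * φ ω) = 0 := by rw [hω, star_zero]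
  rw [star_mul, star_ip] at this
  rw [mul_assoc, this, mul_zero, Pi.zero_apply]

/-- The synthesis operator of a Riesz basis is injective. -/
lemma IsRieszBasis.integral_mul_star_eq_zero (hF : IsBessel A μ F) (hR : IsRieszBasis A μ F)
    (hφ : MemLp φ 2 μ) (h0 : IsWeakIntegral μ φ F 0) :
    ∫ ω, φ ω * star (φ ω) ∂μ = 0 := by
  obtain ⟨hw, B, hB0, hB⟩ := hF
  obtain ⟨-, -, a, C, ha, -, hC⟩ := hR
  have hi := integrable_mul_star hφ hφ
  have hbound (s : Set Ω) (hs : MeasurableSet s) (hμs : μ s < ⊤) :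
      a ^ 2 * ‖∫ ω in s, φ ω * star (φ ω) ∂μ‖ ≤ B * ‖∫ ω in sᶜ, φ ω * star (φ ω) ∂μ‖ := by
    obtain ⟨v, hv, hlow, -⟩ := hC φ (mem_L2_iff.2 hφ) s hs hμs
    -- As `T φ = 0`, the integral over `sᶜ` is `-v`. Since `sᶜ` may have infinite measure, the
    -- Bessel bound is used there.
    have hc : IsWeakIntegral μ (sᶜ.indicator φ) F (0 - v) := by
      have := h0.sub ((isWeakIntegral_indicator_iff hs).2 hv)
      rwa [show (fun ω => φ ω - s.indicator φ ω) = sᶜ.indicator φ from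
        (Set.indicator_compl s φ).symm] at this
    have h1 := hc.norm_sq_le (hφ.indicator hs.compl) hw hB hB0
    rw [zero_sub, norm_neg, ← setIntegral_mul_star hs.compl] at h1
    refine le_trans ?_ h1
    have h2 := pow_le_pow_left₀ (by positivity) hlow 2
    rwa [mul_pow, ← Real.sqrt_eq_rpow, Real.sq_sqrt (norm_nonneg _)] at h2
  set ψ := hφ.1.mk φ with hψ
  have hψm : StronglyMeasurable ψ := hφ.1.stronglyMeasurable_mk
  have hψae : φ =ᵐ[μ] ψ := hφ.1.ae_eq_mk
  have hψ2 : MemLp ψ 2 μ := (memLp_congr_ae hψae).1 hφ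
  -- Level sets of a strongly measurable representative: measurable, of finite measure by Markov,
  -- exhausting its support.
  let s : ℕ → Set Ω := fun n => {ω | ((n : ℝ) + 1)⁻¹ ≤ ‖ψ ω‖ ^ 2}
  have hs (n : ℕ) : MeasurableSet (s n) :=
    measurableSet_le measurable_const (hψm.norm.measurable.pow_const 2)
  have hsq : Integrable (fun ω => ‖ψ ω‖ ^ 2) μ := (memLp_two_iff_integrable_sq_norm hψ2.1).1 hψ2
  have hsfin (n : ℕ) : μ (s n) < ⊤ := by
    have := hsq.measure_norm_ge_lt_top (show (0 : ℝ) < ((n : ℝ) + 1)⁻¹ by positivity)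
    simpa [s] using this
  have hmono : Monotone s := fun m n hmn ω hω => by
    refine le_trans ?_ (show ((m : ℝ) + 1)⁻¹ ≤ ‖ψ ω‖ ^ 2 from hω)
    gcongr
  have hlim : Tendsto (fun n => ∫ ω in s n, φ ω * star (φ ω) ∂μ) atTop
      (𝓝 (∫ ω, φ ω * star (φ ω) ∂μ)) := by
    have h1 := tendsto_setIntegral_of_monotone hs hmono hi.integrableOn
    rwa [setIntegral_eq_integral_of_ae_compl_eq_zero] at h1
    filter_upwards [hψae] with ω hω hmem
    have : ψ ω = 0 := by
      by_contra hne
      obtain ⟨n, hn⟩ := exists_nat_one_div_lt (show 0 < ‖ψ ω‖ ^ 2 by positivity)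
      exact hmem (Set.mem_iUnion.2 ⟨n, by simpa [s] using hn.le⟩)
    rw [hω, this, zero_mul]
  have hlim' : Tendsto (fun n => ∫ ω in (s n)ᶜ, φ ω * star (φ ω) ∂μ) atTop (𝓝 0) := by
    have := (tendsto_const_nhds (x := ∫ ω, φ ω * star (φ ω) ∂μ)).sub hlim
    rw [sub_self] at this
    refine this.congr fun n => ?_
    rw [← integral_add_compl (hs n) hi, add_sub_cancel_left]
  have h1 := le_of_tendsto_of_tendsto' (hlim.norm.const_mul (a ^ 2)) (hlim'.norm.const_mul B)
    fun n => hbound (s n) (hs n) (hsfin n)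
  rw [norm_zero, mul_zero] at h1
  have h2 : 0 < a ^ 2 := by positivity
  rw [← norm_eq_zero]
  exact le_antisymm (nonpos_of_mul_nonpos_right h1 h2) (norm_nonneg _)

lemma IsFrame.isMuComplete (hF : IsFrame A μ F) : IsMuComplete A μ F := by
  obtain ⟨-, a, B, ha, -, -, hlow⟩ := hF
  refine Set.eq_singleton_iff_unique_mem.2 ⟨?_, fun f hf => ?_⟩
  · refine (ae_of_all μ fun ω => ?_ : ∀ᵐ ω ∂μ, ip A (0 : U) (F ω) = 0)
    rw [← sub_self (0 : U), ip_sub_left, sub_self]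
  · have h0 : ∫ ω, ip A f (F ω) * ip A (F ω) f ∂μ = 0 := by
      refine integral_eq_zero_of_ae ?_
      filter_upwards [show ∀ᵐ ω ∂μ, ip A f (F ω) = 0 from hf] with ω hω
      rw [hω, zero_mul, Pi.zero_apply]
    have h1 := hlow f
    rw [h0] at h1
    have h2 := le_antisymm h1 (smul_nonneg ha.le (ip_self_nonneg f))
    exact ip_self_eq_zero (A := A).1 ((smul_eq_zero_iff_right ha.ne').1 h2)

lemma IsRieszType.isRieszBasis [CompleteSpace U]
    (hU : ∀ a : A, (∀ u : U, a • u = 0) → a = 0) (hF : IsRieszType A μ F)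
    (hT : ∀ φ : Ω → A, MemLp φ 2 μ → ∃ v, IsWeakIntegral μ φ F v) : IsRieszBasis A μ F := by
  obtain ⟨hw, a, B, ha, hB0, hB, hlow⟩ := hF.1
  obtain ⟨R, hR, -⟩ := exists_inverse_frameOperator hw ha hB0 hB hlow hT
  -- The `+ 1` keeps the constant positive when `R = 0`.
  refine ⟨hw, hF.1.isMuComplete, (√(B * (‖R‖ + 1) ^ 2))⁻¹, √B, by positivity, by positivity,
    fun φ hφ s hs _ => ?_⟩
  have hψ : MemLp (s.indicator φ) 2 μ := (mem_L2_iff.1 hφ).indicator hs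
  obtain ⟨v, hv⟩ := hT _ hψ
  refine ⟨v, (isWeakIntegral_indicator_iff hs).1 hv, ?_⟩
  rw [setIntegral_mul_star hs, ← Real.sqrt_eq_rpow]
  set ψ := s.indicator φ
  constructor
  -- `ψ` and the coefficients of `R v` both synthesize to `v`, so injectivity makes them equal
  -- almost everywhere.
  · have hχ : MemLp (fun ω => ψ ω - ip A (R v) (F ω)) 2 μ := hψ.sub (hB.memLp_ip hw (R v))
    have hχ0 : IsWeakIntegral μ (fun ω => ψ ω - ip A (R v) (F ω)) F 0 := by
      simpa only [sub_self] using hv.sub (hR v)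
    have hae := ae_eq_zero_of_integral_mul_star_eq_zero hχ
      (hF.integral_mul_star_eq_zero hU hχ hχ0)
    have e : ∫ ω, ψ ω * star (ψ ω) ∂μ = ∫ ω, ip A (R v) (F ω) * ip A (F ω) (R v) ∂μ := by
      refine integral_congr_ae ?_
      filter_upwards [hae] with ω hω
      rw [sub_eq_zero.1 hω, star_ip]
    rw [inv_mul_le_iff₀ (by positivity), e]
    refine Real.sqrt_le_iff.2 ⟨by positivity, (hB.norm_integral_le hB0 (R v)).trans ?_⟩
    rw [mul_pow, Real.sq_sqrt (by positivity), mul_assoc, ← mul_pow]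
    gcongr
    exact (R.le_opNorm v).trans (by gcongr; linarith)
  · rw [← Real.sqrt_mul hB0.le]
    exact Real.le_sqrt_of_sq_le (hv.norm_sq_le hψ hw hB hB0)

lemma IsRieszBasis.isRieszType [CompleteSpace U] (hF : IsFrame A μ F) (hR : IsRieszBasis A μ F)
    (hT : ∀ φ : Ω → A, MemLp φ 2 μ → ∃ v, IsWeakIntegral μ φ F v) : IsRieszType A μ F := by
  obtain ⟨hw, a, B, ha, hB0, hB, hlow⟩ := id hF
  obtain ⟨R, hRi, hRs⟩ := exists_inverse_frameOperator hw ha hB0 hB hlow hT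
  have hd := isDual_inverse_frameOperator hw ha hB hlow hRi hRs
  refine ⟨hF, _, hd, fun G hG f => ?_⟩
  -- The coefficient functions of both duals synthesize to `f`; their difference lies in the kernel.
  have hm := (hd.1.memLp_ip (A := A) f).sub (hG.1.memLp_ip f)
  have h0 := (hd.2 f).sub (hG.2 f)
  rw [sub_self] at h0
  filter_upwards [ae_eq_zero_of_integral_mul_star_eq_zero hm
    (hR.integral_mul_star_eq_zero hF.isBessel hm h0)] with ω hω
  exact sub_eq_zero.1 hω

end Riesz

end ContinuousFrame

theorem mainTheorem3 {Ω A U : Type*} [MeasurableSpace Ω] (μ : Measure Ω)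
    [CStarAlgebra A] [PartialOrder A] [StarOrderedRing A]
    [NormedAddCommGroup U] [NormedSpace ℂ U] [CompleteSpace U] [Module A U] [CStarModule A U]
    (hU : ∀ a : A, (∀ u : U, a • u = 0) → a = 0)
    (F : Ω → U) (hF : ContinuousFrame.IsFrame A μ F)
    (T : ContinuousFrame.L2 A μ → U) (hT : ContinuousFrame.IsPreFrameOperator μ F T) :
    ContinuousFrame.IsRieszBasis A μ F ↔ ContinuousFrame.IsRieszType A μ F := by
  have hT' (φ : Ω → A) (hφ : MemLp φ 2 μ) : ∃ v, ContinuousFrame.IsWeakIntegral μ φ F v :=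
    ⟨T ⟨φ, ContinuousFrame.mem_L2_iff.2 hφ⟩, hT ⟨φ, _⟩⟩
  exact ⟨fun h => h.isRieszType hF hT', fun h => h.isRieszBasis hU hT'⟩
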